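/- Let $\mathcal V=(\mathcal V,\otimes,\mathrm k)$ be a commutative unital quantale with internal hom $[-,-]$. A $\mathcal V$-normed set is a set $X$ with a function $|-|\colon X\to\mathcal V$. A small $\mathcal V$-normed category is a small category $\mathbb A$ whose hom-sets are $\mathcal V$-normed with $\mathrm k\le|1_a|$ and $|g|\otimes|f|\le|g\cdot f|$; a $\mathcal V$-normed functor $F$ satisfies $|f|\le|Ff|$, and a $\mathcal V$-normed natural transformation has components with $\mathrm k\le|\alpha_a|$. $\mathcal V$-normed sets with all maps form a $\mathcal V$-normed category under $|\varphi|=\bigwedge_x[|x|,|\varphi x|]$. A $\mathcal V$-normed distributor $\Phi\colon\mathbb X\nrightarrow\mathbb A$ is a $\mathcal V$-normed functor from $\mathbb X^{\mathrm{op}}\otimes\mathbb A$ (where $|(f,g)|=|f|\otimes|g|$) to this category. Distributors compose by $(\Psi\cdot\Phi)(x,c)=\int^{a}\Psi(a,c)\otimes\Phi(x,a)$, that is, the set of classes $[(v,u)]$, $v\in\Psi(a,c)$, $u\in\Phi(x,a)$, normed by $|z|=\bigvee\{|v|\otimes|u| : z=[(v,u)]\}$; with $\mathcal V$-normed natural transformations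 as 2-cells this gives a bicategory of small $\mathcal V$-normed categories, in which adjointness is understood. A distributor $\Phi\colon\mathbb X\nrightarrow\mathbb A$ is representable if $\Phi\cong F_*=\mathbb A(F-,-)$ for some $\mathcal V$-normed functor $F\colon\mathbb X\to\mathbb A$, and $\mathbb A$ is Lawvere complete if every left adjoint distributor $\mathbb X\nrightarrow\mathbb A$, with $\mathbb X$ any small $\mathcal V$-normed category, is representable. Let $\mathbb E$ be the one-arrow category with object $\star$ and $|1_\star|=\mathrm k$. For $\Phi\colon\mathbb E\nrightarrow\mathbb A$, write $\Phi(a)=\Phi(\star,a)$, and let $\Phi^\vee\colon\mathbb A\nrightarrow\mathbb E$ be its Isbell conjugate: $\Phi^\vee(a)$ is the set of all natural transformations $\beta\colon\Phi\to\mathbb A(a,-)$, normed by $|\beta|=\bigwedge_b\bigwedge_{y\in\Phi(b)}[|y|,|\beta_b(y)|]$. A left adjoint $\Phi\colon\mathbb E\nrightarrow\mathbb A$ has a presentable unit if there are an object $a$ of $\mathbb A$ and elements $u\in\Phi(a)$, $v\in\Phi^\vee(a)$ with $\mathrm k\le|u|$ and $\mathrm k\le|v|$ such that the unit of the adjunction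 $\Phi\dashv\Phi^\vee$ (whose counit is evaluation) is $[(v,u)]$. **Theorem.** For every commutative unital quantale $\mathcal V$, a small $\mathcal V$-normed category $\mathbb A$ is Lawvere complete if and only if 1. the ordinary category $\mathbb A_\circ$, with the objects of $\mathbb A$ and the morphisms $f$ of $\mathbb A$ such that $\mathrm k\le|f|$, is idempotent complete (every idempotent splits); and 2. every left adjoint $\mathcal V$-normed distributor $\Phi\colon\mathbb E\nrightarrow\mathbb A$ has a presentable unit. -/

import Mathlib

open CategoryTheory Opposite
open scoped Quantale Bicategory

universe w u u₁ v₁ u₂ v₂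

/-! ## `V`-normed sets and `V`-normed categories

Throughout, `V` is a commutative unital quantale, written multiplicatively: `*` is the tensor
product, `1` is the neutral element `k`, and `x ⇨ₗ y` is the internal hom `[x, y]`. -/

/-- A `V`-normed set: a set with a function to `V`. -/
structure NormedSet (V : Type w) where
  /-- The underlying set. -/
  carrier : Type u
  /-- The norm. -/
  norm : carrier → V

/-- The norm `⋀ a, [|a|, |φ a|]` of an arbitrary map between `V`-normed sets
(the internal hom of the category of `V`-normed sets). -/
def NormedSet.mapNorm {V : Type w} [CommMonoid V] [CompleteLattice V]
    (A B : NormedSet.{w, u} V) (φ : A.carrier → B.carrier) : V :=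
  ⨅ a : A.carrier, A.norm a ⇨ₗ B.norm (φ a)

/-- `V`-normed sets with arbitrary maps as morphisms. -/
instance NormedSet.category (V : Type w) : Category.{u} (NormedSet.{w, u} V) where
  Hom A B := A.carrier → B.carrier
  id _ := fun a => a
  comp f g := fun a => g (f a)

/-- A `V`-normed category: an ordinary category whose morphisms carry norms with `k ≤ |1_a|` and
`|g| ⊗ |f| ≤ |g · f|`. -/
class VNormedCategory (V : Type w) [CommMonoid V] [CompleteLattice V]
    (A : Type u₁) [Category.{v₁} A] where
  /-- The norm of a morphism. -/
  hnorm : ∀ {a b : A}, (a ⟶ b) → V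
  one_le_hnorm_id : ∀ a : A, 1 ≤ hnorm (𝟙 a)
  hnorm_mul_le : ∀ {a b c : A} (f : a ⟶ b) (g : b ⟶ c), hnorm g * hnorm f ≤ hnorm (f ≫ g)

/-- The norm of a morphism in a `V`-normed category. -/
def hnorm (V : Type w) [CommMonoid V] [CompleteLattice V] {A : Type u₁} [Category.{v₁} A]
    [VNormedCategory V A] {a b : A} (f : a ⟶ b) : V :=
  VNormedCategory.hnorm f

section NormedCategories

variable {V : Type w} [CommMonoid V] [CompleteLattice V]

theorem one_le_hnorm_id {A : Type u₁} [Category.{v₁} A] [VNormedCategory V A] (a : A) :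
    1 ≤ hnorm V (𝟙 a) :=
  VNormedCategory.one_le_hnorm_id a

theorem hnorm_mul_le {A : Type u₁} [Category.{v₁} A] [VNormedCategory V A] {a b c : A}
    (f : a ⟶ b) (g : b ⟶ c) : hnorm V g * hnorm V f ≤ hnorm V (f ≫ g) :=
  VNormedCategory.hnorm_mul_le f g

variable [IsQuantale V]

theorem NormedSet.le_mapNorm_iff {A B : NormedSet.{w, u} V} {φ : A.carrier → B.carrier} {x : V} :
    x ≤ A.mapNorm B φ ↔ ∀ a, x * A.norm a ≤ B.norm (φ a) := by
  simp only [NormedSet.mapNorm, le_iInf_iff, Quantale.leftMulResiduation_le_iff_mul_le]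

/-- The `V`-normed category of `V`-normed sets and arbitrary maps. -/
instance NormedSet.vNormedCategory : VNormedCategory V (NormedSet.{w, u} V) where
  hnorm {A B} φ := A.mapNorm B φ
  one_le_hnorm_id A := NormedSet.le_mapNorm_iff.2 fun a => by rw [one_mul]; exact le_refl _
  hnorm_mul_le {A B C} f g := NormedSet.le_mapNorm_iff.2 fun a => by
    rw [mul_assoc]
    exact le_trans (mul_le_mul_right (NormedSet.le_mapNorm_iff.1 (le_refl (A.mapNorm B f)) a) _)
      (NormedSet.le_mapNorm_iff.1 (le_refl (B.mapNorm C g)) (f a))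

/-- The opposite of a `V`-normed category. -/
instance Opposite.vNormedCategory {A : Type u₁} [Category.{v₁} A] [VNormedCategory V A] :
    VNormedCategory V Aᵒᵖ where
  hnorm f := hnorm V f.unop
  one_le_hnorm_id a := one_le_hnorm_id a.unop
  hnorm_mul_le f g := by
    rw [mul_comm]
    exact hnorm_mul_le g.unop f.unop

/-- The tensor product `A ⊗ B` of `V`-normed categories: the ordinary product category, normed by
`|(f, g)| = |f| ⊗ |g|`. -/
instance Prod.vNormedCategory {A : Type u₁} [Category.{v₁} A] [VNormedCategory V A]
    {B : Type u₂} [Category.{v₂} B] [VNormedCategory V B] : VNormedCategory V (A × B) where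
  hnorm f := hnorm V f.1 * hnorm V f.2
  one_le_hnorm_id a := one_le_mul (one_le_hnorm_id a.1) (one_le_hnorm_id a.2)
  hnorm_mul_le f g := by
    rw [mul_mul_mul_comm]
    exact mul_le_mul' (hnorm_mul_le f.1 g.1) (hnorm_mul_le f.2 g.2)

end NormedCategories

/-- The ordinary category `A_∘`: the objects of `A`, and the morphisms `f` of `A` with
`k ≤ |f|`. -/
structure Underlying (V : Type w) (A : Type u₁) where
  /-- The object of `A`. -/
  obj : A

instance Underlying.category (V : Type w) [CommMonoid V] [CompleteLattice V] [IsQuantale V]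
    (A : Type u₁) [Category.{v₁} A] [VNormedCategory V A] : Category.{v₁} (Underlying V A) where
  Hom a b := {f : a.obj ⟶ b.obj // 1 ≤ hnorm V f}
  id a := ⟨𝟙 a.obj, one_le_hnorm_id a.obj⟩
  comp f g := ⟨f.1 ≫ g.1, le_trans (one_le_mul g.2 f.2) (hnorm_mul_le f.1 g.1)⟩

/-- A `V`-normed functor: a functor with `|f| ≤ |F f|`. -/
structure NormedFunctor (V : Type w) [CommMonoid V] [CompleteLattice V]
    (A : Type u₁) [Category.{v₁} A] [VNormedCategory V A]
    (B : Type u₂) [Category.{v₂} B] [VNormedCategory V B] extends A ⥤ B where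
  hnorm_le : ∀ {a b : A} (f : a ⟶ b), hnorm V f ≤ hnorm V (toFunctor.map f)

/-- A `V`-normed natural transformation: a natural transformation all of whose components
satisfy `k ≤ |α_a|`. -/
@[ext]
structure NormedNatTrans {V : Type w} [CommMonoid V] [CompleteLattice V]
    {A : Type u₁} [Category.{v₁} A] [VNormedCategory V A]
    {B : Type u₂} [Category.{v₂} B] [VNormedCategory V B] (F G : NormedFunctor V A B)
    extends NatTrans F.toFunctor G.toFunctor where
  one_le_hnorm : ∀ a : A, 1 ≤ hnorm V (toNatTrans.app a)

/-- `V`-normed functors and `V`-normed natural transformations form a category. -/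
instance NormedFunctor.category {V : Type w} [CommMonoid V] [CompleteLattice V] [IsQuantale V]
    {A : Type u₁} [Category.{v₁} A] [VNormedCategory V A]
    {B : Type u₂} [Category.{v₂} B] [VNormedCategory V B] :
    Category.{max u₁ v₂} (NormedFunctor V A B) where
  Hom F G := NormedNatTrans F G
  id F := ⟨NatTrans.id F.toFunctor, fun a => one_le_hnorm_id (F.obj a)⟩
  comp α β := ⟨NatTrans.vcomp α.toNatTrans β.toNatTrans, fun a =>
    le_trans (one_le_mul (β.one_le_hnorm a) (α.one_le_hnorm a)) (hnorm_mul_le _ _)⟩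
  id_comp α := NormedNatTrans.ext (by ext; simp)
  comp_id α := NormedNatTrans.ext (by ext; simp)
  assoc α β γ := NormedNatTrans.ext (by ext; simp)

/-! ## Distributors between small `V`-normed categories -/

/-- A `V`-normed distributor `A ⇸ B`: a `V`-normed functor from `Aᵒᵖ ⊗ B` to the `V`-normed
category of `V`-normed sets. -/
abbrev Distributor (V : Type w) [CommMonoid V] [CompleteLattice V] [IsQuantale V]
    (A : Type u) [SmallCategory A] [VNormedCategory V A]
    (B : Type u) [SmallCategory B] [VNormedCategory V B] : Type (max w (u + 1)) :=
  NormedFunctor V (Aᵒᵖ × B) (NormedSet.{w, u} V)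

namespace Distributor

variable {V : Type w} [CommMonoid V] [CompleteLattice V] [IsQuantale V]
  {A : Type u} [SmallCategory A] [VNormedCategory V A]
  {B : Type u} [SmallCategory B] [VNormedCategory V B]
  {C : Type u} [SmallCategory C] [VNormedCategory V C]
  {D : Type u} [SmallCategory D] [VNormedCategory V D]

/-- The set `Φ(a, b)`. -/
abbrev El (Φ : Distributor V A B) (a : A) (b : B) : Type u := (Φ.obj (op a, b)).carrier

/-- The norm of an element of `Φ(a, b)`. -/
abbrev nrm (Φ : Distributor V A B) {a : A} {b : B} (x : Φ.El a b) : V :=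
  (Φ.obj (op a, b)).norm x

/-- The map `Φ(f, g) : Φ(a, b) → Φ(a', b')`. -/
def act (Φ : Distributor V A B) {a a' : A} {b b' : B} (f : a' ⟶ a) (g : b ⟶ b') (x : Φ.El a b) :
    Φ.El a' b' :=
  Φ.map (X := (op a, b)) (Y := (op a', b')) (f.op, g) x

theorem act_id (Φ : Distributor V A B) {a : A} {b : B} (x : Φ.El a b) :
    Φ.act (𝟙 a) (𝟙 b) x = x :=
  congrFun (Φ.map_id (op a, b)) x

theorem act_act (Φ : Distributor V A B) {a a' a'' : A} {b b' b'' : B} (f : a' ⟶ a) (g : b ⟶ b')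
    (f' : a'' ⟶ a') (g' : b' ⟶ b'') (x : Φ.El a b) :
    Φ.act f' g' (Φ.act f g x) = Φ.act (f' ≫ f) (g ≫ g') x :=
  (congrFun (Φ.map_comp (X := (op a, b)) (Y := (op a', b')) (Z := (op a'', b''))
    (f.op, g) (f'.op, g')) x).symm

theorem nrm_act (Φ : Distributor V A B) {a a' : A} {b b' : B} (f : a' ⟶ a) (g : b ⟶ b')
    (x : Φ.El a b) : hnorm V f * hnorm V g * Φ.nrm x ≤ Φ.nrm (Φ.act f g x) :=
  NormedSet.le_mapNorm_iff.1
    (Φ.hnorm_le (a := (op a, b)) (b := (op a', b')) (f.op, g)) x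

theorem nrm_act_left (Φ : Distributor V A B) {a a' : A} {b : B} (f : a' ⟶ a)
    (x : Φ.El a b) : hnorm V f * Φ.nrm x ≤ Φ.nrm (Φ.act f (𝟙 b) x) :=
  le_trans (mul_le_mul_left (le_mul_of_one_le_right' (one_le_hnorm_id b)) _) (Φ.nrm_act f (𝟙 b) x)

theorem nrm_act_right (Φ : Distributor V A B) {a : A} {b b' : B} (g : b ⟶ b')
    (x : Φ.El a b) : hnorm V g * Φ.nrm x ≤ Φ.nrm (Φ.act (𝟙 a) g x) :=
  le_trans (mul_le_mul_left (le_mul_of_one_le_left' (one_le_hnorm_id a)) _) (Φ.nrm_act (𝟙 a) g x)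

/-- Construct a distributor from its values and the two-sided action. -/
def ofAct (obj : A → B → NormedSet.{w, u} V)
    (act : ∀ {a a' : A} {b b' : B}, (a' ⟶ a) → (b ⟶ b') →
      (obj a b).carrier → (obj a' b').carrier)
    (act_id : ∀ {a : A} {b : B} (x : (obj a b).carrier), act (𝟙 a) (𝟙 b) x = x)
    (act_act : ∀ {a a' a'' : A} {b b' b'' : B} (f : a' ⟶ a) (g : b ⟶ b') (f' : a'' ⟶ a')
      (g' : b' ⟶ b'') (x : (obj a b).carrier),
      act f' g' (act f g x) = act (f' ≫ f) (g ≫ g') x)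
    (norm_act : ∀ {a a' : A} {b b' : B} (f : a' ⟶ a) (g : b ⟶ b') (x : (obj a b).carrier),
      hnorm V f * hnorm V g * (obj a b).norm x ≤ (obj a' b').norm (act f g x)) :
    Distributor V A B where
  obj p := obj p.1.unop p.2
  map f := fun x => act f.1.unop f.2 x
  map_id _ := funext fun x => act_id x
  map_comp f g := funext fun x => (act_act f.1.unop f.2 g.1.unop g.2 x).symm
  hnorm_le f := NormedSet.le_mapNorm_iff.2 fun x => norm_act f.1.unop f.2 x

/-- The component `Φ(a, b) → Φ'(a, b)` of a `V`-normed natural transformation. -/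
def ap {Φ Φ' : Distributor V A B} (α : Φ ⟶ Φ') {a : A} {b : B} (x : Φ.El a b) : Φ'.El a b :=
  NatTrans.app (NormedNatTrans.toNatTrans α) (op a, b) x

theorem ap_act {Φ Φ' : Distributor V A B} (α : Φ ⟶ Φ') {a a' : A} {b b' : B} (f : a' ⟶ a)
    (g : b ⟶ b') (x : Φ.El a b) : ap α (Φ.act f g x) = Φ'.act f g (ap α x) :=
  congrFun (NatTrans.naturality (NormedNatTrans.toNatTrans α) (X := (op a, b))
    (Y := (op a', b')) (f.op, g)) x

theorem nrm_ap {Φ Φ' : Distributor V A B} (α : Φ ⟶ Φ') {a : A} {b : B} (x : Φ.El a b) :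
    Φ.nrm x ≤ Φ'.nrm (ap α x) := by
  have h := NormedSet.le_mapNorm_iff.1 (NormedNatTrans.one_le_hnorm α (op a, b)) x
  rwa [one_mul] at h

/-- Construct a `V`-normed natural transformation between distributors from its components. -/
def homMk {Φ Φ' : Distributor V A B} (app : ∀ (a : A) (b : B), Φ.El a b → Φ'.El a b)
    (natural : ∀ {a a' : A} {b b' : B} (f : a' ⟶ a) (g : b ⟶ b') (x : Φ.El a b),
      app a' b' (Φ.act f g x) = Φ'.act f g (app a b x))
    (nrm_le : ∀ (a : A) (b : B) (x : Φ.El a b), Φ.nrm x ≤ Φ'.nrm (app a b x)) : Φ ⟶ Φ' :=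
  NormedNatTrans.mk
    { app := fun p => app p.1.unop p.2
      naturality := fun _ _ f => funext fun x => natural f.1.unop f.2 x }
    (fun p => NormedSet.le_mapNorm_iff.2 fun x => by
      rw [one_mul]; exact nrm_le p.1.unop p.2 x)

theorem hom_ext {Φ Φ' : Distributor V A B} {α β : Φ ⟶ Φ'}
    (h : ∀ (a : A) (b : B) (x : Φ.El a b), ap α x = ap β x) : α = β :=
  NormedNatTrans.ext (funext fun p : Aᵒᵖ × B => funext fun x => h p.1.unop p.2 x)

@[simp] theorem ap_homMk {Φ Φ' : Distributor V A B}
    (app : ∀ (a : A) (b : B), Φ.El a b → Φ'.El a b) (natural) (nrm_le) {a : A} {b : B}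
    (x : Φ.El a b) : ap (homMk (Φ := Φ) (Φ' := Φ') app natural nrm_le) x = app a b x :=
  rfl

@[simp] theorem ap_id (Φ : Distributor V A B) {a : A} {b : B} (x : Φ.El a b) : ap (𝟙 Φ) x = x :=
  rfl

@[simp] theorem ap_comp {Φ Φ' Φ'' : Distributor V A B} (α : Φ ⟶ Φ') (β : Φ' ⟶ Φ'')
    {a : A} {b : B} (x : Φ.El a b) : ap (α ≫ β) x = ap β (ap α x) :=
  rfl

/-- The identity distributor `A(-, -) : A ⇸ A`. -/
def homDist (V : Type w) [CommMonoid V] [CompleteLattice V] [IsQuantale V]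
    (A : Type u) [SmallCategory A] [VNormedCategory V A] : Distributor V A A :=
  ofAct (fun a b => ⟨a ⟶ b, fun f => hnorm V f⟩) (fun f g x => f ≫ x ≫ g)
    (by simp) (by simp)
    (fun f g x => by
      rw [mul_assoc, mul_comm]
      exact le_trans (mul_le_mul_left (hnorm_mul_le x g) _) (hnorm_mul_le f (x ≫ g)))

/-- The distributor `F_* : A ⇸ B`, `F_*(a, b) = B(F a, b)`, of a `V`-normed functor `F`. -/
def lowerStar (F : NormedFunctor V A B) : Distributor V A B :=
  ofAct (fun a b => ⟨F.obj a ⟶ b, fun f => hnorm V f⟩) (fun f g x => F.map f ≫ x ≫ g)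
    (by simp) (by simp)
    (fun f g x => by
      rw [mul_assoc, mul_comm]
      exact le_trans (mul_le_mul_left (hnorm_mul_le x g) _)
        (le_trans (mul_le_mul_right (F.hnorm_le f) _) (hnorm_mul_le (F.map f) (x ≫ g))))

/-! ### Composition -/

/-- The generating relation `(v, Φ(1, h) u) ~ (Ψ(h, 1) v, u)` on `∑ b, Ψ(b, c) × Φ(a, b)`. -/
inductive CompRel (Φ : Distributor V A B) (Ψ : Distributor V B C) (a : A) (c : C) :
    (Σ b : B, Ψ.El b c × Φ.El a b) → (Σ b : B, Ψ.El b c × Φ.El a b) → Prop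
  | rel {b b' : B} (h : b ⟶ b') (v : Ψ.El b' c) (u : Φ.El a b) :
      CompRel Φ Ψ a c ⟨b', v, Φ.act (𝟙 a) h u⟩ ⟨b, Ψ.act h (𝟙 c) v, u⟩

/-- The underlying set of `(Ψ · Φ)(a, c)`, the coend of `Ψ(b, c) × Φ(a, b)` over `b`. -/
def CompEl (Φ : Distributor V A B) (Ψ : Distributor V B C) (a : A) (c : C) : Type u :=
  Quot (CompRel Φ Ψ a c)

/-- The final norm on the coend: `|z| = ⋁ { |v| ⊗ |u| : z = [(v, u)] }`. -/
def compNorm (Φ : Distributor V A B) (Ψ : Distributor V B C) (a : A) (c : C)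
    (z : CompEl Φ Ψ a c) : V :=
  ⨆ t : {t : Σ b : B, Ψ.El b c × Φ.El a b // Quot.mk (CompRel Φ Ψ a c) t = z},
    Ψ.nrm t.1.2.1 * Φ.nrm t.1.2.2

theorem nrm_mul_le_compNorm (Φ : Distributor V A B) (Ψ : Distributor V B C) {a : A} {c : C} {b : B}
    (v : Ψ.El b c) (u : Φ.El a b) :
    Ψ.nrm v * Φ.nrm u ≤ compNorm Φ Ψ a c (Quot.mk _ ⟨b, v, u⟩) :=
  le_iSup (fun t : {t : Σ b : B, Ψ.El b c × Φ.El a b //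
      Quot.mk (CompRel Φ Ψ a c) t = Quot.mk _ ⟨b, v, u⟩} =>
    Ψ.nrm t.1.2.1 * Φ.nrm t.1.2.2) ⟨⟨b, v, u⟩, rfl⟩

theorem mul_compNorm_le {Φ : Distributor V A B} {Ψ : Distributor V B C} {a : A} {c : C}
    {x : V} {F : CompEl Φ Ψ a c → V}
    (h : ∀ (b : B) (v : Ψ.El b c) (u : Φ.El a b),
      x * (Ψ.nrm v * Φ.nrm u) ≤ F (Quot.mk _ ⟨b, v, u⟩)) (z : CompEl Φ Ψ a c) :
    x * compNorm Φ Ψ a c z ≤ F z := by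
  rw [compNorm, Quantale.mul_iSup_distrib]
  refine iSup_le ?_
  rintro ⟨⟨b, v, u⟩, rfl⟩
  exact h b v u

/-- The composite `Ψ · Φ : A ⇸ C`. -/
def compDist (Φ : Distributor V A B) (Ψ : Distributor V B C) : Distributor V A C :=
  ofAct (fun a c => ⟨CompEl Φ Ψ a c, compNorm Φ Ψ a c⟩)
    (fun {a a' c c'} f g =>
      Quot.map (fun t => ⟨t.1, Ψ.act (𝟙 t.1) g t.2.1, Φ.act f (𝟙 t.1) t.2.2⟩)
        (by
          rintro _ _ ⟨h, v, u⟩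
          rename_i b b'
          have h₁ : Φ.act f (𝟙 b') (Φ.act (𝟙 a) h u) = Φ.act (𝟙 a') h (Φ.act f (𝟙 b) u) := by
            simp [act_act]
          have h₂ : Ψ.act (𝟙 b) g (Ψ.act h (𝟙 c) v) = Ψ.act h (𝟙 c') (Ψ.act (𝟙 b') g v) := by
            simp [act_act]
          simp only [h₁, h₂]
          exact CompRel.rel h _ _))
    (fun z => by
      obtain ⟨b, v, u⟩ := z
      simp only [Quot.map, act_id]
      rfl)
    (fun f g f' g' z => by
      obtain ⟨b, v, u⟩ := z
      simp only [Quot.map, act_act, Category.comp_id]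
      rfl)
    (fun f g z => by
      refine mul_compNorm_le (F := fun z => compNorm Φ Ψ _ _ _) ?_ z
      intro b v u
      refine le_trans ?_ (nrm_mul_le_compNorm Φ Ψ _ _)
      rw [mul_comm (hnorm V f), mul_mul_mul_comm]
      exact mul_le_mul' (Ψ.nrm_act_right g v) (Φ.nrm_act_left f u))

/-- The class `[(v, u)]`. -/
def pair (Φ : Distributor V A B) (Ψ : Distributor V B C) {a : A} {c : C} {b : B}
    (v : Ψ.El b c) (u : Φ.El a b) : (compDist Φ Ψ).El a c :=
  Quot.mk (CompRel Φ Ψ a c) ⟨b, v, u⟩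

theorem pair_eq (Φ : Distributor V A B) (Ψ : Distributor V B C) {a : A} {c : C} {b b' : B}
    (h : b ⟶ b') (v : Ψ.El b' c) (u : Φ.El a b) :
    pair Φ Ψ v (Φ.act (𝟙 a) h u) = pair Φ Ψ (Ψ.act h (𝟙 c) v) u :=
  Quot.sound (CompRel.rel h v u)

theorem comp_ind {Φ : Distributor V A B} {Ψ : Distributor V B C} {a : A} {c : C}
    {p : (compDist Φ Ψ).El a c → Prop}
    (h : ∀ (b : B) (v : Ψ.El b c) (u : Φ.El a b), p (pair Φ Ψ v u))
    (z : (compDist Φ Ψ).El a c) : p z :=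
  Quot.ind (fun t => h t.1 t.2.1 t.2.2) z

/-- Maps out of the coend. -/
def compLift {Φ : Distributor V A B} {Ψ : Distributor V B C} {a : A} {c : C} {T : Type*}
    (F : ∀ b : B, Ψ.El b c → Φ.El a b → T)
    (hF : ∀ {b b' : B} (h : b ⟶ b') (v : Ψ.El b' c) (u : Φ.El a b),
      F b' v (Φ.act (𝟙 a) h u) = F b (Ψ.act h (𝟙 c) v) u) (z : (compDist Φ Ψ).El a c) : T :=
  Quot.lift (fun t => F t.1 t.2.1 t.2.2) (by rintro _ _ ⟨h, v, u⟩; exact hF h v u) z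

@[simp] theorem compLift_pair {Φ : Distributor V A B} {Ψ : Distributor V B C} {a : A} {c : C}
    {T : Type*} (F : ∀ b : B, Ψ.El b c → Φ.El a b → T) (hF) {b : B} (v : Ψ.El b c)
    (u : Φ.El a b) : compLift (Φ := Φ) (Ψ := Ψ) F hF (pair Φ Ψ v u) = F b v u :=
  rfl

theorem le_nrm_pair (Φ : Distributor V A B) (Ψ : Distributor V B C) {a : A} {c : C} {b : B}
    (v : Ψ.El b c) (u : Φ.El a b) :
    Ψ.nrm v * Φ.nrm u ≤ (compDist Φ Ψ).nrm (pair Φ Ψ v u) :=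
  nrm_mul_le_compNorm Φ Ψ v u

theorem mul_nrm_comp_le {Φ : Distributor V A B} {Ψ : Distributor V B C} {a : A} {c : C}
    {x : V} {F : (compDist Φ Ψ).El a c → V}
    (h : ∀ (b : B) (v : Ψ.El b c) (u : Φ.El a b),
      x * (Ψ.nrm v * Φ.nrm u) ≤ F (pair Φ Ψ v u)) (z : (compDist Φ Ψ).El a c) :
    x * (compDist Φ Ψ).nrm z ≤ F z :=
  mul_compNorm_le h z

theorem nrm_comp_mul_le {Φ : Distributor V A B} {Ψ : Distributor V B C} {a : A} {c : C}
    {x : V} {F : (compDist Φ Ψ).El a c → V}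
    (h : ∀ (b : B) (v : Ψ.El b c) (u : Φ.El a b),
      (Ψ.nrm v * Φ.nrm u) * x ≤ F (pair Φ Ψ v u)) (z : (compDist Φ Ψ).El a c) :
    (compDist Φ Ψ).nrm z * x ≤ F z := by
  rw [mul_comm]
  exact mul_nrm_comp_le (fun b v u => by rw [mul_comm]; exact h b v u) z

theorem nrm_comp_le {Φ : Distributor V A B} {Ψ : Distributor V B C} {a : A} {c : C}
    {F : (compDist Φ Ψ).El a c → V}
    (h : ∀ (b : B) (v : Ψ.El b c) (u : Φ.El a b), Ψ.nrm v * Φ.nrm u ≤ F (pair Φ Ψ v u))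
    (z : (compDist Φ Ψ).El a c) : (compDist Φ Ψ).nrm z ≤ F z := by
  have := mul_nrm_comp_le (x := 1) (F := F) (fun b v u => by rw [one_mul]; exact h b v u) z
  rwa [one_mul] at this

@[simp] theorem compDist_act_pair (Φ : Distributor V A B) (Ψ : Distributor V B C) {a a' : A}
    {c c' : C} (f : a' ⟶ a) (g : c ⟶ c') {b : B} (v : Ψ.El b c) (u : Φ.El a b) :
    (compDist Φ Ψ).act f g (pair Φ Ψ v u) = pair Φ Ψ (Ψ.act (𝟙 b) g v) (Φ.act f (𝟙 b) u) :=
  rfl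

@[simp] theorem homDist_act {a a' b b' : A} (f : a' ⟶ a) (g : b ⟶ b') (x : a ⟶ b) :
    (homDist V A).act f g x = f ≫ x ≫ g :=
  rfl

/-- Construct a transformation out of a composite. -/
def compHomMk {Φ : Distributor V A B} {Ψ : Distributor V B C} {Θ : Distributor V A C}
    (F : ∀ {a : A} {c : C} (b : B), Ψ.El b c → Φ.El a b → Θ.El a c)
    (hF : ∀ {a : A} {c : C} {b b' : B} (h : b ⟶ b') (v : Ψ.El b' c) (u : Φ.El a b),
      F b' v (Φ.act (𝟙 a) h u) = F b (Ψ.act h (𝟙 c) v) u)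
    (natural : ∀ {a a' : A} {c c' : C} (f : a' ⟶ a) (g : c ⟶ c') (b : B) (v : Ψ.El b c)
      (u : Φ.El a b), F b (Ψ.act (𝟙 b) g v) (Φ.act f (𝟙 b) u) = Θ.act f g (F b v u))
    (nrm_le : ∀ {a : A} {c : C} (b : B) (v : Ψ.El b c) (u : Φ.El a b),
      Ψ.nrm v * Φ.nrm u ≤ Θ.nrm (F b v u)) : compDist Φ Ψ ⟶ Θ :=
  homMk (fun _ _ => compLift F hF)
    (fun f g z => by
      induction z using comp_ind with
      | h b v u => exact natural f g b v u)
    (fun a c z => nrm_comp_le (F := fun z => Θ.nrm (compLift F hF z)) nrm_le z)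

@[simp] theorem ap_compHomMk {Φ : Distributor V A B} {Ψ : Distributor V B C}
    {Θ : Distributor V A C} (F : ∀ {a : A} {c : C} (b : B), Ψ.El b c → Φ.El a b → Θ.El a c)
    (hF) (natural) (nrm_le) {a : A} {c : C} {b : B} (v : Ψ.El b c) (u : Φ.El a b) :
    ap (compHomMk (Φ := Φ) (Ψ := Ψ) (Θ := Θ) F hF natural nrm_le) (pair Φ Ψ v u) = F b v u :=
  rfl

theorem comp_hom_ext {Φ : Distributor V A B} {Ψ : Distributor V B C} {Θ : Distributor V A C}
    {α β : compDist Φ Ψ ⟶ Θ}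
    (h : ∀ (a : A) (c : C) (b : B) (v : Ψ.El b c) (u : Φ.El a b),
      ap α (pair Φ Ψ v u) = ap β (pair Φ Ψ v u)) : α = β :=
  hom_ext fun a c z => by
    induction z using comp_ind with
    | h b v u => exact h a c b v u

/-- Whiskering on the side of the first factor. -/
def whiskL (Φ : Distributor V A B) {Ψ Ψ' : Distributor V B C} (β : Ψ ⟶ Ψ') :
    compDist Φ Ψ ⟶ compDist Φ Ψ' :=
  compHomMk (fun _ v u => pair Φ Ψ' (ap β v) u)
    (fun h v u => by rw [pair_eq, ap_act])
    (fun f g b v u => by rw [ap_act, compDist_act_pair])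
    (fun b v u => le_trans (mul_le_mul_left (nrm_ap β v) _) (le_nrm_pair Φ Ψ' _ _))

/-- Whiskering on the side of the second factor. -/
def whiskR {Φ Φ' : Distributor V A B} (α : Φ ⟶ Φ') (Ψ : Distributor V B C) :
    compDist Φ Ψ ⟶ compDist Φ' Ψ :=
  compHomMk (fun _ v u => pair Φ' Ψ v (ap α u))
    (fun h v u => by rw [ap_act, pair_eq])
    (fun f g b v u => by rw [ap_act, compDist_act_pair])
    (fun b v u => le_trans (mul_le_mul_right (nrm_ap α u) _) (le_nrm_pair Φ' Ψ _ _))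

/-- `[(t, [(v, u)])] ↦ [([(t, v)], u)]`. -/
def assocHom (Φ : Distributor V A B) (Ψ : Distributor V B C) (Θ : Distributor V C D) :
    compDist (compDist Φ Ψ) Θ ⟶ compDist Φ (compDist Ψ Θ) :=
  compHomMk
    (fun {a d} c t z => compLift (fun b v u => pair Φ (compDist Ψ Θ) (pair Ψ Θ t v) u)
      (fun {b b'} h v u => by
        rw [pair_eq, compDist_act_pair, act_id]) z)
    (fun {a d c c'} h t z => by
      induction z using comp_ind with
      | h b v u => simp [act_id, pair_eq])
    (fun {a a' d d'} f g c t z => by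
      induction z using comp_ind with
      | h b v u => simp [act_id])
    (fun {a d} c t z => by
      refine mul_nrm_comp_le (F := fun z => (compDist Φ (compDist Ψ Θ)).nrm (compLift _ _ z)) ?_ z
      intro b v u
      rw [← mul_assoc]
      exact le_trans (mul_le_mul_left (le_nrm_pair Ψ Θ t v) _)
        (le_nrm_pair Φ (compDist Ψ Θ) _ _))

/-- `[([(t, v)], u)] ↦ [(t, [(v, u)])]`. -/
def assocInv (Φ : Distributor V A B) (Ψ : Distributor V B C) (Θ : Distributor V C D) :
    compDist Φ (compDist Ψ Θ) ⟶ compDist (compDist Φ Ψ) Θ :=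
  compHomMk
    (fun {a d} b z u => compLift (fun c t v => pair (compDist Φ Ψ) Θ t (pair Φ Ψ v u))
      (fun {c c'} h t v => by
        rw [← pair_eq, compDist_act_pair, act_id]) z)
    (fun {a d b b'} h z u => by
      induction z using comp_ind with
      | h c t v => simp [act_id, pair_eq])
    (fun {a a' d d'} f g b z u => by
      induction z using comp_ind with
      | h c t v => simp [act_id])
    (fun {a d} b z u => by
      refine nrm_comp_mul_le (F := fun z => (compDist (compDist Φ Ψ) Θ).nrm (compLift _ _ z)) ?_ z
      intro c t v
      rw [mul_assoc]
      exact le_trans (mul_le_mul_right (le_nrm_pair Φ Ψ v u) _)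
        (le_nrm_pair (compDist Φ Ψ) Θ _ _))

/-- The associativity isomorphism `Θ · (Ψ · Φ) ≅ (Θ · Ψ) · Φ`. -/
def assocIso (Φ : Distributor V A B) (Ψ : Distributor V B C) (Θ : Distributor V C D) :
    compDist (compDist Φ Ψ) Θ ≅ compDist Φ (compDist Ψ Θ) where
  hom := assocHom Φ Ψ Θ
  inv := assocInv Φ Ψ Θ
  hom_inv_id := comp_hom_ext fun a d c t z => by
    induction z using comp_ind with
    | h b v u => rfl
  inv_hom_id := comp_hom_ext fun a d b z u => by
    induction z using comp_ind with
    | h c t v => rfl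

/-- The unit isomorphism `Φ · A ≅ Φ`. -/
def leftUnitIso (Φ : Distributor V A B) : compDist (homDist V A) Φ ≅ Φ where
  hom := compHomMk (fun {a c} b v (f : a ⟶ b) => Φ.act f (𝟙 c) v)
    (fun h v (f : _ ⟶ _) => by simp [act_act])
    (fun f g b v (h : _ ⟶ _) => by simp [act_act])
    (fun b v (f : _ ⟶ _) => by rw [mul_comm]; exact Φ.nrm_act_left f v)
  inv := homMk (fun a _ x => pair (homDist V A) Φ x (𝟙 a))
    (fun {a a' b b'} f g x => by
      have h := pair_eq (homDist V A) Φ f (Φ.act (𝟙 a) g x) (𝟙 a')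
      simp only [homDist_act, act_act, Category.comp_id, Category.id_comp] at h
      rw [← h]
      exact congrArg (pair (homDist V A) Φ (Φ.act (𝟙 a) g x))
        (show f = f ≫ 𝟙 a ≫ 𝟙 a by simp))
    (fun a b x => le_trans (le_mul_of_one_le_right' (one_le_hnorm_id a))
      (le_nrm_pair (homDist V A) Φ x (𝟙 a)))
  hom_inv_id := comp_hom_ext fun a c b v (f : a ⟶ b) => by
    have h := pair_eq (homDist V A) Φ f v (𝟙 a)
    simp only [homDist_act, Category.id_comp] at h
    exact h.symm
  inv_hom_id := hom_ext fun a b x => Φ.act_id x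

/-- The unit isomorphism `B · Φ ≅ Φ`. -/
def rightUnitIso (Φ : Distributor V A B) : compDist Φ (homDist V B) ≅ Φ where
  hom := compHomMk (fun {a c} b (g : b ⟶ c) u => Φ.act (𝟙 a) g u)
    (fun h (g : _ ⟶ _) u => by simp [act_act])
    (fun f g b (h : _ ⟶ _) u => by simp [act_act])
    (fun b (g : _ ⟶ _) u => Φ.nrm_act_right g u)
  inv := homMk (fun _ b x => pair Φ (homDist V B) (𝟙 b) x)
    (fun {a a' b b'} f g x => by
      have h := pair_eq Φ (homDist V B) g (𝟙 b') (Φ.act f (𝟙 b) x)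
      simp only [homDist_act, act_act, Category.comp_id, Category.id_comp] at h
      rw [h]
      exact congrArg (fun t => pair Φ (homDist V B) t (Φ.act f (𝟙 b) x))
        (show g = 𝟙 b ≫ 𝟙 b ≫ g by simp))
    (fun a b x => le_trans (le_mul_of_one_le_left' (one_le_hnorm_id b))
      (le_nrm_pair Φ (homDist V B) (𝟙 b) x))
  hom_inv_id := comp_hom_ext fun a c b (g : b ⟶ c) u => by
    have h := pair_eq Φ (homDist V B) g (𝟙 c) u
    simp only [homDist_act, Category.comp_id] at h
    exact h
  inv_hom_id := hom_ext fun a b x => Φ.act_id x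

end Distributor

/-! ## The bicategory of distributors -/

/-- Small `V`-normed categories, as the objects of the bicategory of `V`-normed distributors. -/
structure NCat (V : Type w) [CommMonoid V] [CompleteLattice V] : Type (max w (u + 1)) where
  /-- The type of objects. -/
  carrier : Type u
  [category : SmallCategory carrier]
  [normed : VNormedCategory V carrier]

attribute [instance] NCat.category NCat.normed

/-- The bicategory of small `V`-normed categories, `V`-normed distributors and `V`-normed natural
transformations. In diagrammatic notation, `Φ ≫ Ψ` is the composite `Ψ · Φ`. -/
instance NCat.bicategory (V : Type w) [CommMonoid V] [CompleteLattice V] [IsQuantale V] :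
    Bicategory.{u, max w (u + 1)} (NCat.{w, u} V) where
  Hom X Y := Distributor V X.carrier Y.carrier
  id X := Distributor.homDist V X.carrier
  comp Φ Ψ := Distributor.compDist Φ Ψ
  homCategory X Y := inferInstanceAs (Category (Distributor V X.carrier Y.carrier))
  whiskerLeft Φ _ _ β := Distributor.whiskL Φ β
  whiskerRight α Ψ := Distributor.whiskR α Ψ
  associator Φ Ψ Θ := Distributor.assocIso Φ Ψ Θ
  leftUnitor Φ := Distributor.leftUnitIso Φ
  rightUnitor Φ := Distributor.rightUnitIso Φ
  whiskerLeft_id _ _ := Distributor.comp_hom_ext fun _ _ _ _ _ => rfl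
  whiskerLeft_comp _ _ _ _ _ _ := Distributor.comp_hom_ext fun _ _ _ _ _ => rfl
  id_whiskerLeft {X _ _ Φ'} η := Distributor.comp_hom_ext
    fun a c b (v : Distributor.El _ b c) (f : a ⟶ b) => by
      have h := Distributor.pair_eq (Distributor.homDist V X.carrier) Φ' f
        (Distributor.ap η v) (𝟙 a)
      rw [← Distributor.ap_act, Distributor.homDist_act, Category.id_comp, Category.id_comp] at h
      exact h
  comp_whiskerLeft _ _ _ _ _ := Distributor.comp_hom_ext fun a c b v z => by
    induction z using Distributor.comp_ind with
    | h => rfl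
  id_whiskerRight _ _ := Distributor.comp_hom_ext fun _ _ _ _ _ => rfl
  comp_whiskerRight _ _ _ := Distributor.comp_hom_ext fun _ _ _ _ _ => rfl
  whiskerRight_id {_ Y _ Φ'} η := Distributor.comp_hom_ext
    fun a c b (g : b ⟶ c) (u : Distributor.El _ a b) => by
      have h := Distributor.pair_eq Φ' (Distributor.homDist V Y.carrier) g (𝟙 c)
        (Distributor.ap η u)
      rw [← Distributor.ap_act, Distributor.homDist_act, Category.comp_id, Category.comp_id] at h
      exact h.symm
  whiskerRight_comp _ _ _ := Distributor.comp_hom_ext fun a c b z u => by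
    induction z using Distributor.comp_ind with
    | h => rfl
  whisker_assoc _ _ _ _ _ := Distributor.comp_hom_ext fun a c b v z => by
    induction z using Distributor.comp_ind with
    | h => rfl
  whisker_exchange _ _ := Distributor.comp_hom_ext fun _ _ _ _ _ => rfl
  pentagon _ _ _ _ := Distributor.comp_hom_ext fun a c b v z => by
    induction z using Distributor.comp_ind with
    | h b' v' z =>
      induction z using Distributor.comp_ind with
      | h => rfl
  triangle Φ Ψ := Distributor.comp_hom_ext fun a c b v z => by
    induction z using Distributor.comp_ind with
    | h b' f u => exact (Distributor.pair_eq Φ Ψ f v u).symm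

/-! ## Isbell conjugates, presentable units, Lawvere completeness -/

namespace Distributor

variable {V : Type w} [CommMonoid V] [CompleteLattice V] [IsQuantale V]
  {X : Type u} [SmallCategory X] [VNormedCategory V X]
  {A : Type u} [SmallCategory A] [VNormedCategory V A]

/-- An arbitrary (not necessarily `V`-normed) natural transformation `Φ(x, -) → A(a, -)`. -/
@[ext]
structure IsbellEl (Φ : Distributor V X A) (a : A) (x : X) : Type u where
  /-- The components. -/
  app : ∀ b : A, Φ.El x b → (a ⟶ b)
  natural : ∀ {b b' : A} (g : b ⟶ b') (y : Φ.El x b), app b' (Φ.act (𝟙 x) g y) = app b y ≫ g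

/-- The hom-set `A(a, b)` as a `V`-normed set. -/
def homSet (V : Type w) [CommMonoid V] [CompleteLattice V] {A : Type u} [SmallCategory A]
    [VNormedCategory V A] (a b : A) : NormedSet.{w, u} V :=
  ⟨a ⟶ b, fun f => hnorm V f⟩

/-- The norm of a natural transformation: the infimum over `b` of the norms of the maps
`Φ(x, b) → A(a, b)`. -/
def isbellNorm (Φ : Distributor V X A) (a : A) (x : X) (β : IsbellEl Φ a x) : V :=
  ⨅ b : A, (Φ.obj (op x, b)).mapNorm (homSet V a b) (β.app b)

theorem le_isbellNorm_iff {Φ : Distributor V X A} {a : A} {x : X} {β : IsbellEl Φ a x} {t : V} :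
    t ≤ isbellNorm Φ a x β ↔ ∀ (b : A) (y : Φ.El x b), t * Φ.nrm y ≤ hnorm V (β.app b y) := by
  rw [isbellNorm, le_iInf_iff]
  exact forall_congr' fun b => NormedSet.le_mapNorm_iff

/-- The Isbell conjugate `Φ^∨ : A ⇸ X`. Its value at `(a, x)` is the `V`-normed set
`[A, nSet](Φ(x, -), A(a, -))`. For the unit category `X` this is the usual Isbell conjugate. -/
def isbell (Φ : Distributor V X A) : Distributor V A X :=
  ofAct (fun a x => ⟨IsbellEl Φ a x, isbellNorm Φ a x⟩)
    (fun {a a' x x'} f g β =>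
      { app := fun b y => f ≫ β.app b (Φ.act g (𝟙 b) y)
        natural := fun {b b'} h y => by
          have e : Φ.act g (𝟙 b') (Φ.act (𝟙 x') h y) = Φ.act (𝟙 x) h (Φ.act g (𝟙 b) y) := by
            simp [act_act]
          rw [e, β.natural, Category.assoc] })
    (fun β => IsbellEl.ext (by funext b y; simp [act_id]))
    (fun f g f' g' β => IsbellEl.ext (by funext b y; simp [act_act]))
    (fun {a a' x x'} f g β => le_isbellNorm_iff.2 fun b y => by
      refine le_trans ?_ (hnorm_mul_le f (β.app b (Φ.act g (𝟙 b) y)))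
      have h₁ := le_isbellNorm_iff.1 (le_refl (isbellNorm Φ a x β)) b (Φ.act g (𝟙 b) y)
      have h₂ := mul_le_mul_right (Φ.nrm_act_left g y) (isbellNorm Φ a x β)
      have h₃ := mul_le_mul_right (le_trans h₂ h₁) (hnorm V f)
      rw [mul_comm (hnorm V (β.app b (Φ.act g (𝟙 b) y)))]
      rw [mul_assoc, mul_assoc, mul_left_comm (hnorm V g)]
      exact h₃)

/-- The evaluation `ε_Φ : Φ · Φ^∨ → A`, `[(y, β)] ↦ β y`. -/
def isbellCounit (Φ : Distributor V X A) : compDist (isbell Φ) Φ ⟶ homDist V A :=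
  compHomMk (fun {_ b} _ (y : Φ.El _ b) (β : IsbellEl Φ _ _) => β.app b y)
    (fun {a b x x'} h y (β : IsbellEl Φ a x) =>
      show 𝟙 a ≫ β.app b (Φ.act h (𝟙 b) y) = β.app b (Φ.act h (𝟙 b) y) by simp)
    (fun {a a' b b'} f g x y (β : IsbellEl Φ a x) =>
      show f ≫ β.app b' (Φ.act (𝟙 x) (𝟙 b') (Φ.act (𝟙 x) g y)) = f ≫ β.app b y ≫ g by
        rw [act_id, β.natural])
    (fun {a b} x y (β : IsbellEl Φ a x) => by
      rw [mul_comm]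
      exact le_isbellNorm_iff.1 (le_refl (isbellNorm Φ a x β)) b y)

end Distributor

/-- The one-arrow category is `V`-normed by `|1_⋆| = k`. -/
instance unitVNormedCategory {V : Type w} [CommMonoid V] [CompleteLattice V] :
    VNormedCategory V (Discrete PUnit.{u + 1}) where
  hnorm _ := 1
  one_le_hnorm_id _ := le_refl _
  hnorm_mul_le _ _ := by rw [one_mul]

/-- The one-arrow `V`-normed category `E`. -/
def NCat.unit (V : Type w) [CommMonoid V] [CompleteLattice V] : NCat.{w, u} V :=
  ⟨Discrete PUnit.{u + 1}⟩

section Completeness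

variable {V : Type w} [CommMonoid V] [CompleteLattice V] [IsQuantale V]

/-- The unique object of `E`. -/
def NCat.star : (NCat.unit.{w, u} V).carrier :=
  Discrete.mk PUnit.unit

/-- The Isbell conjugate as a 1-cell of the bicategory of distributors. -/
def NCat.isbell {X A : NCat.{w, u} V} (Φ : X ⟶ A) : A ⟶ X :=
  Distributor.isbell Φ

/-- A distributor `Φ : X ⇸ A` is representable if `Φ ≅ F_*` for some `V`-normed functor
`F : X → A`. -/
def NCat.Representable {X A : NCat.{w, u} V} (Φ : X ⟶ A) : Prop :=
  ∃ F : NormedFunctor V X.carrier A.carrier,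
    Nonempty (Φ ≅ (Distributor.lowerStar F : X ⟶ A))

/-- `A` is Lawvere complete if every left adjoint distributor from a small `V`-normed category to
`A` is representable. -/
def NCat.LawvereComplete (A : NCat.{w, u} V) : Prop :=
  ∀ (X : NCat.{w, u} V) (Φ : X ⟶ A), Bicategory.IsLeftAdjoint Φ → NCat.Representable Φ

/-- `Φ : E ⇸ A` has a presentable unit: `Φ` is left adjoint to `Φ^∨` with counit `ε_Φ`, and
the (hence uniquely determined) unit is of the form `[(v, u)]` with `k ≤ |u|` and `k ≤ |v|`. -/
def NCat.HasPresentableUnit {A : NCat.{w, u} V} (Φ : NCat.unit V ⟶ A) : Prop :=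
  ∃ adj : Bicategory.Adjunction Φ (NCat.isbell Φ),
    adj.counit = Distributor.isbellCounit Φ ∧
    ∃ (a : A.carrier) (u : Distributor.El Φ NCat.star a)
      (v : Distributor.El (NCat.isbell Φ) a NCat.star),
      Distributor.ap adj.unit (𝟙 NCat.star) = Distributor.pair Φ (NCat.isbell Φ) v u ∧
      1 ≤ Distributor.nrm Φ u ∧ 1 ≤ Distributor.nrm (NCat.isbell Φ) v

end Completeness

/-!
An adjunction of distributors is read off on elements: if the unit sends `𝟙 x` to `[(v, u)]`, the
triangle identities say that every `y ∈ Φ(x, b)` equals `ε[(y, v)] · u`, and that every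
`w ∈ Ψ(b, x)` equals `v · ε[(u, w)]`. Both directions of the theorem compare left adjoints with
distributors `Φ` all of whose `Φ(x, -)` are isometrically isomorphic to hom-functors
(`Distributor.Representation`); these are exactly the representable ones
(`NCat.representable_iff`).

Suppose `A` is Lawvere complete. A representation of `Φ : E ⇸ A` gives the presentable unit
`[(v, u)]`, where `u` is the universal element and `v` the isomorphism with the hom-functor. An
idempotent `e` of `A_∘` on `a` makes the distributor of all `f : a ⟶ b` with `e ≫ f = f` left
adjoint, with unit `[(e, e)]`, and a representing object of it splits `e`.

Conversely, each `Φ(x, -)` of a left adjoint `Φ : X ⇸ A` is a left adjoint `E ⇸ A`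
(`NCat.isLeftAdjoint_restrict`), so it has a presentable unit `[(v, u)]` with `u ∈ Φ(x, a)`. The
triangle identity makes `v u : a ⟶ a` an idempotent of `A_∘`, and a splitting of it through `c`
represents `Φ(x, -)` by `c` (`NCat.nonempty_representation_of_hasPresentableUnit`). The
representing objects are then functorial in `x`.
-/

/-! ### Adjunctions in terms of elements -/

namespace Distributor

variable {V : Type w} [CommMonoid V] [CompleteLattice V] [IsQuantale V]
  {A : Type u} [SmallCategory A] [VNormedCategory V A]
  {B : Type u} [SmallCategory B] [VNormedCategory V B]

theorem act_right_act_left (Φ : Distributor V A B) {a a' : A} {b b' : B} (f : a' ⟶ a)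
    (g : b ⟶ b') (x : Φ.El a b) :
    Φ.act f (𝟙 b') (Φ.act (𝟙 a) g x) = Φ.act (𝟙 a') g (Φ.act f (𝟙 b) x) := by
  simp [act_act]

theorem pair_homDist_left (Φ : Distributor V A B) {a a' : A} {b : B} (f : a ⟶ a')
    (y : Φ.El a' b) :
    pair (homDist V A) Φ y f = pair (homDist V A) Φ (Φ.act f (𝟙 b) y) (𝟙 a) := by
  have e := pair_eq (homDist V A) Φ f y (𝟙 a)
  rwa [homDist_act, Category.id_comp, Category.id_comp] at e

theorem pair_homDist_right (Φ : Distributor V A B) {a : A} {b b' : B} (g : b ⟶ b')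
    (y : Φ.El a b) :
    pair Φ (homDist V B) g y = pair Φ (homDist V B) (𝟙 b') (Φ.act (𝟙 a) g y) := by
  have e := pair_eq Φ (homDist V B) g (𝟙 b') y
  rw [homDist_act, Category.comp_id, Category.comp_id] at e
  exact e.symm

end Distributor

namespace NCat
open Distributor
variable {V : Type w} [CommMonoid V] [CompleteLattice V] [IsQuantale V] {X A : NCat.{w, u} V}

/-- The left zigzag sends `[(y, 𝟙)]` to `[(κ[(y, v)], u)]` when `η (𝟙 x) = [(v, u)]`. The proofs of
this and of `ap_rightZigzag` end in `rfl` because all structure maps compute on classes. -/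
theorem ap_leftZigzag {Φ : X ⟶ A} {Ψ : A ⟶ X} (η : 𝟙 X ⟶ Φ ≫ Ψ) (κ : Ψ ≫ Φ ⟶ 𝟙 A)
    {x : X.carrier} {a b : A.carrier} (v : Distributor.El Ψ a x) (u : Distributor.El Φ x a)
    (h : ap η (𝟙 x) = pair Φ Ψ v u) (y : Distributor.El Φ x b) :
    ap (Bicategory.leftZigzag η κ) (pair (homDist V X.carrier) Φ y (𝟙 x)) =
      pair Φ (homDist V A.carrier) (ap κ (pair Ψ Φ y v)) u := by
  have e : Bicategory.leftZigzag η κ =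
      Bicategory.whiskerRight η Φ ≫ (Bicategory.associator Φ Ψ Φ).hom ≫
        Bicategory.whiskerLeft Φ κ := by
    simp [bicategoricalComp]
  rw [e]
  change ap (whiskL Φ κ) (ap (assocHom Φ Ψ Φ) (pair _ Φ y (ap η (𝟙 x)))) = _
  rw [h]
  rfl

theorem ap_rightZigzag {Φ : X ⟶ A} {Ψ : A ⟶ X} (η : 𝟙 X ⟶ Φ ≫ Ψ) (κ : Ψ ≫ Φ ⟶ 𝟙 A)
    {x : X.carrier} {a b : A.carrier} (v : Distributor.El Ψ a x) (u : Distributor.El Φ x a)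
    (h : ap η (𝟙 x) = pair Φ Ψ v u) (y : Distributor.El Ψ b x) :
    ap (Bicategory.rightZigzag η κ) (pair Ψ (homDist V X.carrier) (𝟙 x) y) =
      pair (homDist V A.carrier) Ψ v (ap κ (pair Ψ Φ u y)) := by
  have e : Bicategory.rightZigzag η κ =
      Bicategory.whiskerLeft Ψ η ≫ (Bicategory.associator Ψ Φ Ψ).inv ≫
        Bicategory.whiskerRight κ Ψ := by
    simp [bicategoricalComp]
  rw [e]
  change ap (whiskR κ Ψ) (ap (assocInv Ψ Φ Ψ) (pair Ψ _ (ap η (𝟙 x)) y)) = _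
  rw [h]
  rfl

/-- The left triangle identity on elements: `κ[(y, v)] · u = y`, where `[(v, u)]` is the unit at `x`
and `κ` the counit. -/
theorem act_counit {Φ : X ⟶ A} {Ψ : A ⟶ X} (adj : Bicategory.Adjunction Φ Ψ)
    {x : X.carrier} {a b : A.carrier} {v : Distributor.El Ψ a x} {u : Distributor.El Φ x a}
    (h : ap adj.unit (𝟙 x) = pair Φ Ψ v u) (y : Distributor.El Φ x b) :
    Distributor.act Φ (𝟙 x) (ap adj.counit (pair Ψ Φ y v)) u = y := by
  have h₁ := ap_leftZigzag adj.unit adj.counit v u h y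
  rw [adj.left_triangle] at h₁
  have h₂ := congrArg (ap (rightUnitIso Φ).hom) h₁
  refine Eq.trans h₂.symm ?_
  change Distributor.act Φ (𝟙 x) (𝟙 b) (Distributor.act Φ (𝟙 x) (𝟙 b) y) = y
  rw [Distributor.act_id, Distributor.act_id]

/-- The right triangle identity on elements: `v · κ[(u, y)] = y`, where `[(v, u)]` is the unit at `x`
and `κ` the counit. -/
theorem counit_act {Φ : X ⟶ A} {Ψ : A ⟶ X} (adj : Bicategory.Adjunction Φ Ψ)
    {x : X.carrier} {a b : A.carrier} {v : Distributor.El Ψ a x} {u : Distributor.El Φ x a}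
    (h : ap adj.unit (𝟙 x) = pair Φ Ψ v u) (y : Distributor.El Ψ b x) :
    Distributor.act Ψ (ap adj.counit (pair Ψ Φ u y)) (𝟙 x) v = y := by
  have h₁ := ap_rightZigzag adj.unit adj.counit v u h y
  rw [adj.right_triangle] at h₁
  have h₂ := congrArg (ap (leftUnitIso Ψ).hom) h₁
  refine Eq.trans h₂.symm ?_
  change Distributor.act Ψ (𝟙 b) (𝟙 x) (Distributor.act Ψ (𝟙 b) (𝟙 x) y) = y
  rw [Distributor.act_id, Distributor.act_id]

/-- An adjunction `Φ ⊣ Ψ` from a unit given on identities by `η (𝟙 x) = [(v x, u x)]`: since an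
element `[(y, f)]` of `Φ · X` equals `[(Φ(f, 1) y, 𝟙)]`, it suffices to check the triangle
identities against identities of `X`. -/
def adjunctionMk {Φ : X ⟶ A} {Ψ : A ⟶ X} (η : 𝟙 X ⟶ Φ ≫ Ψ) (κ : Ψ ≫ Φ ⟶ 𝟙 A)
    {a : X.carrier → A.carrier} (v : ∀ x, Distributor.El Ψ (a x) x)
    (u : ∀ x, Distributor.El Φ x (a x))
    (h : ∀ x, ap η (𝟙 x) = pair Φ Ψ (v x) (u x))
    (hl : ∀ x b (y : Distributor.El Φ x b),
      Distributor.act Φ (𝟙 x) (ap κ (pair Ψ Φ y (v x))) (u x) = y)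
    (hr : ∀ x b (y : Distributor.El Ψ b x),
      Distributor.act Ψ (ap κ (pair Ψ Φ (u x) y)) (𝟙 x) (v x) = y) :
    Bicategory.Adjunction Φ Ψ where
  unit := η
  counit := κ
  left_triangle := comp_hom_ext fun x b x' y (f : x ⟶ x') =>
    calc
      _ = ap (Bicategory.leftZigzag η κ)
            (pair (homDist V X.carrier) Φ (Distributor.act Φ f (𝟙 b) y) (𝟙 x)) :=
        congrArg _ (pair_homDist_left Φ f y)
      _ = _ := ap_leftZigzag η κ (v x) (u x) (h x) _
      _ = _ := pair_homDist_right Φ _ (u x)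
      _ = _ := congrArg (pair Φ (homDist V A.carrier) (𝟙 b)) (hl x b _)
  right_triangle := comp_hom_ext fun b x x' (f : x' ⟶ x) y =>
    calc
      _ = ap (Bicategory.rightZigzag η κ)
            (pair Ψ (homDist V X.carrier) (𝟙 x) (Distributor.act Ψ (𝟙 b) f y)) :=
        congrArg _ (pair_homDist_right Ψ f y)
      _ = _ := ap_rightZigzag η κ (v x) (u x) (h x) _
      _ = _ := pair_homDist_left Ψ _ (v x)
      _ = _ := congrArg (fun t => pair (homDist V A.carrier) Ψ t (𝟙 b)) (hr x b _)

instance (x y : (NCat.unit.{w, u} V).carrier) : Subsingleton (x ⟶ y) :=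
  inferInstanceAs (Subsingleton (@Discrete.mk PUnit.{u + 1} x.as ⟶ Discrete.mk y.as))

/-- The transformation `E → Ψ · Φ` of distributors `E ⇸ E` picking out an element `z` with
`k ≤ |z|`. -/
def unitOfElement {Φ : Distributor V (NCat.unit.{w, u} V).carrier A.carrier}
    {Ψ : Distributor V A.carrier (NCat.unit.{w, u} V).carrier}
    (z : (compDist Φ Ψ).El NCat.star NCat.star) (hz : 1 ≤ (compDist Φ Ψ).nrm z) :
    homDist V (NCat.unit.{w, u} V).carrier ⟶ compDist Φ Ψ :=
  homMk (fun _ _ _ => z)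
    (fun {_ _ _ _} f g _ => by
      obtain rfl : f = 𝟙 NCat.star := Subsingleton.elim _ _
      obtain rfl : g = 𝟙 NCat.star := Subsingleton.elim _ _
      exact ((compDist Φ Ψ).act_id z).symm)
    (fun _ _ _ => hz)

/-- A distributor `Φ : E ⇸ A` is left adjoint as soon as some class `[(v, u)]` of norm at least `k`
satisfies the triangle identities with a counit `κ`. The bound is on the norm of the class, not on
those of `v` and `u`. -/
theorem isLeftAdjoint_of_element {Φ : NCat.unit.{w, u} V ⟶ A} {Ψ : A ⟶ NCat.unit.{w, u} V}
    (κ : Ψ ≫ Φ ⟶ 𝟙 A) {a : A.carrier} (v : Distributor.El Ψ a NCat.star)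
    (u : Distributor.El Φ NCat.star a)
    (h : 1 ≤ Distributor.nrm (compDist Φ Ψ) (pair Φ Ψ v u))
    (hl : ∀ b (y : Distributor.El Φ NCat.star b),
      Distributor.act Φ (𝟙 NCat.star) (ap κ (pair Ψ Φ y v)) u = y)
    (hr : ∀ b (y : Distributor.El Ψ b NCat.star),
      Distributor.act Ψ (ap κ (pair Ψ Φ u y)) (𝟙 NCat.star) v = y) :
    Bicategory.IsLeftAdjoint Φ :=
  .mk (adjunctionMk (unitOfElement (pair Φ Ψ v u) h) κ (fun _ => v) (fun _ => u) (fun _ => rfl)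
    (fun _ => hl) (fun _ => hr))

end NCat

/-! ### Representations -/

namespace Distributor

variable {V : Type w} [CommMonoid V] [CompleteLattice V] [IsQuantale V]
  {X : Type u} [SmallCategory X] [VNormedCategory V X]
  {A : Type u} [SmallCategory A] [VNormedCategory V A]

/-- A representation of `Φ(x, -)`: an isometric natural isomorphism with `A(obj, -)`, encoded by
the universal element corresponding to the identity of `obj` and the map `coord` into
`A(obj, -)`. -/
structure Representation (Φ : Distributor V X A) (x : X) where
  /-- The representing object. -/
  obj : A
  /-- The universal element. -/
  elt : Φ.El x obj
  /-- The morphism by which an element arises from the universal one. -/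
  coord : ∀ {b : A}, Φ.El x b → (obj ⟶ b)
  act_coord : ∀ {b : A} (y : Φ.El x b), Φ.act (𝟙 x) (coord y) elt = y
  coord_act : ∀ {b : A} (g : obj ⟶ b), coord (Φ.act (𝟙 x) g elt) = g
  one_le_nrm : 1 ≤ Φ.nrm elt
  nrm_le : ∀ {b : A} (y : Φ.El x b), Φ.nrm y ≤ hnorm V (coord y)

namespace Representation

variable {Φ : Distributor V X A} {x : X}

theorem coord_natural (R : Φ.Representation x) {b b' : A} (g : b ⟶ b') (y : Φ.El x b) :
    R.coord (Φ.act (𝟙 x) g y) = R.coord y ≫ g := by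
  conv_lhs => rw [← R.act_coord y, act_act, Category.comp_id, R.coord_act]

theorem coord_elt (R : Φ.Representation x) : R.coord R.elt = 𝟙 R.obj := by
  rw [← R.coord_act (𝟙 R.obj), act_id]

/-- `R.coord` as an element of the Isbell conjugate. -/
def isbellEl (R : Φ.Representation x) : IsbellEl Φ R.obj x where
  app _ y := R.coord y
  natural g y := R.coord_natural g y

theorem one_le_isbellNorm (R : Φ.Representation x) :
    1 ≤ isbellNorm Φ R.obj x R.isbellEl :=
  le_isbellNorm_iff.2 fun b y => by rw [one_mul]; exact R.nrm_le y

/-- A family of representations of the `Φ(x, -)` makes the representing objects functorial in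
`x`: `f : x ⟶ x'` is sent to the coordinate of `Φ(f, 1)` applied to the universal element
at `x'`. -/
def functor (R : ∀ x, Φ.Representation x) : NormedFunctor V X A where
  obj x := (R x).obj
  map {x x'} f := (R x).coord (Φ.act f (𝟙 _) (R x').elt)
  map_id x := by rw [act_id, coord_elt]
  map_comp {x y z} f g := by
    rw [← coord_natural, ← act_right_act_left, act_coord, act_act, Category.comp_id]
  hnorm_le {x x'} f :=
    calc hnorm V f ≤ hnorm V f * Φ.nrm (R x').elt := le_mul_of_one_le_right' (R x').one_le_nrm
      _ ≤ Φ.nrm (Φ.act f (𝟙 _) (R x').elt) := Φ.nrm_act_left f _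
      _ ≤ _ := (R x).nrm_le _

/-- A representation of every `Φ(x, -)` identifies `Φ` with the distributor `F_*` of the induced
functor. -/
def iso (R : ∀ x, Φ.Representation x) : Φ ≅ lowerStar (functor R) where
  hom := homMk (fun x _ y => (R x).coord y)
    (fun {x x' b b'} f g y => by
      change _ = (R x').coord (Φ.act f (𝟙 _) (R x).elt) ≫ (R x).coord y ≫ g
      rw [← coord_natural, ← coord_natural, ← act_right_act_left, act_coord, act_act,
        Category.comp_id, Category.comp_id])
    (fun x _ y => (R x).nrm_le y)
  inv := homMk (fun x _ g => Φ.act (𝟙 x) g (R x).elt)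
    (fun {x x' b b'} f g (h : (R x).obj ⟶ b) => by
      change Φ.act (𝟙 x') ((R x').coord (Φ.act f (𝟙 _) (R x).elt) ≫ h ≫ g) (R x').elt = _
      rw [← Category.id_comp (𝟙 x'), ← act_act, act_coord, act_act, Category.id_comp,
        Category.id_comp]
      exact (congrArg (fun t => Φ.act t (h ≫ g) (R x).elt) (Category.comp_id f).symm).trans
        (Φ.act_act (𝟙 x) h f g (R x).elt).symm)
    (fun x _ g => le_trans (le_mul_of_one_le_right' (R x).one_le_nrm)
      (Φ.nrm_act_right g (R x).elt))
  hom_inv_id := hom_ext fun x _ y => (R x).act_coord y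
  inv_hom_id := hom_ext fun x _ g => (R x).coord_act g

/-- The Yoneda lemma for `F_*`: a transformation is determined by its values on identities. -/
theorem act_ap_id {F : NormedFunctor V X A} (α : lowerStar F ⟶ Φ) {x : X} {b : A}
    (g : F.obj x ⟶ b) :
    Φ.act (𝟙 x) g (ap α (𝟙 (F.obj x) : F.obj x ⟶ F.obj x)) = ap α g := by
  have e : F.map (𝟙 x) ≫ 𝟙 _ ≫ g = g := by
    rw [F.map_id, Category.id_comp, Category.id_comp]
  exact (ap_act α (𝟙 x) g (𝟙 (F.obj x) : F.obj x ⟶ F.obj x)).symm.trans (congrArg (ap α) e)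

/-- An isomorphism `Φ ≅ F_*` represents each `Φ(x, -)` by `F x`. -/
def ofIso {F : NormedFunctor V X A} (α : Φ ≅ lowerStar F) (x : X) : Φ.Representation x where
  obj := F.obj x
  elt := ap α.inv (𝟙 (F.obj x) : F.obj x ⟶ F.obj x)
  coord y := ap α.hom y
  act_coord y := (act_ap_id α.inv _).trans (congrArg (fun t => ap t y) α.hom_inv_id)
  coord_act {b} (g : F.obj x ⟶ b) :=
    (congrArg (ap α.hom) (act_ap_id α.inv g)).trans
      (congrArg (fun t : lowerStar F ⟶ lowerStar F => ap t g) α.inv_hom_id)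
  one_le_nrm := le_trans (one_le_hnorm_id (F.obj x))
    (nrm_ap α.inv (𝟙 (F.obj x) : F.obj x ⟶ F.obj x))
  nrm_le y := nrm_ap α.hom y

end Representation
end Distributor

/-- Representability is objectwise: no compatibility between the representations of the `Φ(x, -)` is
needed, since functoriality of the representing objects is automatic. -/
theorem NCat.representable_iff {V : Type w} [CommMonoid V] [CompleteLattice V] [IsQuantale V]
    {X A : NCat.{w, u} V} (Φ : X ⟶ A) :
    NCat.Representable Φ ↔ ∀ x, Nonempty (Distributor.Representation Φ x) := by
  constructor
  · rintro ⟨F, ⟨α⟩⟩ x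
    exact ⟨.ofIso (F := F) α x⟩
  · intro h
    exact ⟨_, ⟨Distributor.Representation.iso fun x => (h x).some⟩⟩

/-! ### Presentable units -/

namespace NCat
open Distributor

variable {V : Type w} [CommMonoid V] [CompleteLattice V] [IsQuantale V] {A : NCat.{w, u} V}

/-- The presenting pair of the unit consists of the representing isomorphism and the universal
element. -/
theorem hasPresentableUnit_of_representation {Φ : NCat.unit.{w, u} V ⟶ A}
    (R : Distributor.Representation Φ NCat.star) : NCat.HasPresentableUnit Φ := by
  have hv := R.one_le_isbellNorm
  refine ⟨adjunctionMk (unitOfElement (pair Φ (NCat.isbell Φ) R.isbellEl R.elt)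
      (le_trans (one_le_mul hv R.one_le_nrm) (le_nrm_pair Φ (NCat.isbell Φ) R.isbellEl R.elt)))
      (isbellCounit Φ) (fun _ => R.isbellEl) (fun _ => R.elt) (fun _ => rfl)
      (fun _ _ y => R.act_coord y) ?_, rfl, R.obj, R.elt, R.isbellEl, rfl, R.one_le_nrm, hv⟩
  intro x b β
  refine IsbellEl.ext (funext fun c => funext fun (y : Distributor.El Φ NCat.star c) => ?_)
  let β' : IsbellEl Φ b NCat.star := β
  change β'.app _ R.elt ≫ R.coord (Distributor.act Φ (𝟙 NCat.star) (𝟙 c) y) = β'.app c y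
  rw [Distributor.act_id, ← β'.natural]
  exact congrArg (β'.app c) (R.act_coord y)

/-- A presentable unit `[(v, u)]` makes `v u` an idempotent of norm at least `k`, and a
splitting `i ≫ p = 𝟙`, `p ≫ i = v u` turns it into the representation with universal element
`p · u` and coordinate map `i ≫ v -`. -/
theorem nonempty_representation_of_hasPresentableUnit
    [IsIdempotentComplete (Underlying V A.carrier)] {Φ : NCat.unit.{w, u} V ⟶ A}
    (h : NCat.HasPresentableUnit Φ) : Nonempty (Distributor.Representation Φ NCat.star) := by
  obtain ⟨adj, hκ, a, u, v, hη, hu, hv⟩ := h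
  let β : IsbellEl Φ a NCat.star := v
  have hβ : ∀ {b : A.carrier} (y : Distributor.El Φ NCat.star b),
      Distributor.nrm Φ y ≤ hnorm V (β.app b y) := fun {b} y => by
    have := le_isbellNorm_iff.1 hv b y
    rwa [one_mul] at this
  have hact : ∀ {b : A.carrier} (y : Distributor.El Φ NCat.star b),
      Distributor.act Φ (𝟙 NCat.star) (β.app b y) u = y := fun y => by
    have := act_counit adj hη y
    rwa [hκ] at this
  have happ : ∀ {b : A.carrier} (y : Distributor.El Φ NCat.star b),
      β.app a u ≫ β.app b y = β.app b y := fun y => by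
    rw [← β.natural, hact]
  let e : (⟨a⟩ : Underlying V A.carrier) ⟶ ⟨a⟩ := Subtype.mk (β.app a u) (hu.trans (hβ u))
  obtain ⟨⟨c⟩, i', p', hip, hpi⟩ :=
    IsIdempotentComplete.idempotents_split _ e (Subtype.ext (happ u))
  obtain ⟨i, hi⟩ : {f : c ⟶ a // 1 ≤ hnorm V f} := i'
  obtain ⟨p, hp⟩ : {f : a ⟶ c // 1 ≤ hnorm V f} := p'
  replace hip : i ≫ p = 𝟙 c := congrArg Subtype.val hip
  replace hpi : p ≫ i = β.app a u := congrArg Subtype.val hpi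
  exact ⟨{
    obj := c
    elt := Distributor.act Φ (𝟙 NCat.star) p u
    coord := fun {b} y => i ≫ β.app b y
    act_coord := fun y => by
      rw [Distributor.act_act, Category.comp_id, reassoc_of% hpi, happ, hact]
    coord_act := fun g => by
      rw [β.natural, β.natural, ← hpi]
      simp [reassoc_of% hip, hip]
    one_le_nrm := (one_le_mul hp hu).trans (Distributor.nrm_act_right Φ p u)
    nrm_le := fun {b} y => calc
      Distributor.nrm Φ y ≤ hnorm V (β.app b y) := hβ y
      _ ≤ hnorm V (β.app b y) * hnorm V i := le_mul_of_one_le_right' hi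
      _ ≤ _ := hnorm_mul_le _ _ }⟩

end NCat

/-! ### Restriction to an object -/

namespace Distributor

variable {V : Type w} [CommMonoid V] [CompleteLattice V] [IsQuantale V] {X A : NCat.{w, u} V}

/-- The distributor `Φ(x, -) : E ⇸ A`. -/
def restrict (Φ : Distributor V X.carrier A.carrier) (x : X.carrier) :
    Distributor V (NCat.unit.{w, u} V).carrier A.carrier :=
  ofAct (fun _ b => Φ.obj (op x, b)) (fun _ g y => Φ.act (𝟙 x) g y)
    (fun y => Φ.act_id y) (fun f g f' g' y => by rw [act_act, Category.comp_id])
    (fun f g y => by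
      change 1 * _ * _ ≤ _
      rw [one_mul]
      exact Φ.nrm_act_right g y)

/-- The distributor `Ψ(-, x) : A ⇸ E`. -/
def corestrict (Ψ : Distributor V A.carrier X.carrier) (x : X.carrier) :
    Distributor V A.carrier (NCat.unit.{w, u} V).carrier :=
  ofAct (fun b _ => Ψ.obj (op b, x)) (fun f _ y => Ψ.act f (𝟙 x) y)
    (fun y => Ψ.act_id y) (fun f g f' g' y => by rw [act_act, Category.comp_id])
    (fun f g y => by
      change _ * 1 * _ ≤ _
      rw [mul_one]
      exact Ψ.nrm_act_left f y)

/-- A representation of `Φ(x, -)` as a distributor on `E` is one of `Φ` at `x`. -/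
def Representation.ofRestrict {Φ : Distributor V X.carrier A.carrier} {x : X.carrier}
    (R : (Φ.restrict x).Representation NCat.star) : Φ.Representation x where
  obj := R.obj
  elt := R.elt
  coord := R.coord
  act_coord := R.act_coord
  coord_act := R.coord_act
  one_le_nrm := R.one_le_nrm
  nrm_le := R.nrm_le

end Distributor

namespace NCat
open Distributor

variable {V : Type w} [CommMonoid V] [CompleteLattice V] [IsQuantale V] {X A : NCat.{w, u} V}

/-- If `Φ` is left adjoint to `Ψ`, then `Φ(x, -)` is left adjoint to `Ψ(-, x)`. -/
theorem isLeftAdjoint_restrict {Φ : X ⟶ A} (hΦ : Bicategory.IsLeftAdjoint Φ) (x : X.carrier) :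
    Bicategory.IsLeftAdjoint (a := NCat.unit.{w, u} V) (b := A) (Distributor.restrict Φ x) := by
  obtain ⟨⟨Ψ, adj⟩⟩ := hΦ
  let Φx : Distributor V (NCat.unit.{w, u} V).carrier A.carrier := Distributor.restrict Φ x
  let Ψx : Distributor V A.carrier (NCat.unit.{w, u} V).carrier := Distributor.corestrict Ψ x
  -- The coends `(Ψ · Φ)(x, x)` and `Ψ(-, x) · Φ(x, -)` agree, but as quotients by relations over
  -- different categories; `T` is the comparison.
  let T : (compDist Φ Ψ).El x x → (compDist Φx Ψx).El NCat.star NCat.star :=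
    compLift (fun _ v u => pair Φx Ψx v u) (fun h v u => pair_eq Φx Ψx h v u)
  have hT : ∀ z, (compDist Φ Ψ).nrm z ≤ (compDist Φx Ψx).nrm (T z) :=
    nrm_comp_le (F := fun z => (compDist Φx Ψx).nrm (T z)) fun _ v u => le_nrm_pair Φx Ψx v u
  let κ : compDist Ψx Φx ⟶ homDist V A.carrier :=
    compHomMk (fun {_ _} _ y v => ap adj.counit (pair Ψ Φ y v))
      (fun {_ _ _ _} _ y v =>
        congrArg (ap adj.counit) (pair_eq Ψ Φ (𝟙 x) y v))
      (fun {_ _ _ _} f g _ y v => ap_act adj.counit f g (pair Ψ Φ y v))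
      (fun {_ _} _ y v => (le_nrm_pair Ψ Φ y v).trans (nrm_ap adj.counit (pair Ψ Φ y v)))
  have h1 : 1 ≤ (compDist Φ Ψ).nrm (ap adj.unit (𝟙 x)) :=
    (one_le_hnorm_id x).trans (nrm_ap adj.unit (a := x) (b := x) (𝟙 x))
  obtain ⟨a, v, u, h⟩ : ∃ (a : A.carrier) (v : Distributor.El Ψ a x) (u : Distributor.El Φ x a),
      ap adj.unit (𝟙 x) = pair Φ Ψ v u := by
    generalize ap adj.unit (𝟙 x) = z
    induction z using comp_ind with
    | h a v u => exact ⟨a, v, u, rfl⟩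
  rw [h] at h1
  exact isLeftAdjoint_of_element (Ψ := Ψx) κ v u (h1.trans (hT _))
    (fun _ y => act_counit adj h y) (fun _ y => counit_act adj h y)

end NCat

/-! ### Splitting idempotents -/

namespace Distributor

variable {V : Type w} [CommMonoid V] [CompleteLattice V] [IsQuantale V] {A : NCat.{w, u} V}

/-- The distributor `E ⇸ A` of the morphisms `f` out of `a` with `e ≫ f = f`. -/
def fixedOut {a : A.carrier} (e : a ⟶ a) :
    Distributor V (NCat.unit.{w, u} V).carrier A.carrier :=
  ofAct (fun _ b => ⟨{f : a ⟶ b // e ≫ f = f}, fun f => hnorm V f.1⟩)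
    (fun _ g f => ⟨f.1 ≫ g, by rw [← Category.assoc, f.2]⟩)
    (fun f => Subtype.ext (Category.comp_id f.1))
    (fun _ g _ g' f => Subtype.ext (Category.assoc f.1 g g'))
    (fun _ g f => by
      change 1 * _ * _ ≤ _
      rw [one_mul]
      exact hnorm_mul_le f.1 g)

/-- The distributor `A ⇸ E` of the morphisms `f` into `a` with `f ≫ e = f`. -/
def fixedIn {a : A.carrier} (e : a ⟶ a) :
    Distributor V A.carrier (NCat.unit.{w, u} V).carrier :=
  ofAct (fun b _ => ⟨{f : b ⟶ a // f ≫ e = f}, fun f => hnorm V f.1⟩)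
    (fun g _ f => ⟨g ≫ f.1, by rw [Category.assoc, f.2]⟩)
    (fun f => Subtype.ext (Category.id_comp f.1))
    (fun g _ g' _ f => Subtype.ext (Category.assoc g' g f.1).symm)
    (fun g _ f => by
      change _ * 1 * _ ≤ _
      rw [mul_one, mul_comm]
      exact hnorm_mul_le g f.1)

end Distributor

namespace NCat
open Distributor

variable {V : Type w} [CommMonoid V] [CompleteLattice V] [IsQuantale V] {A : NCat.{w, u} V}

/-- The unit of the adjunction with `fixedIn e` is `[(e, e)]`, and the counit is composition. -/
theorem isLeftAdjoint_fixedOut {a : A.carrier} (e : a ⟶ a) (he : e ≫ e = e)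
    (hn : 1 ≤ hnorm V e) :
    Bicategory.IsLeftAdjoint (a := NCat.unit.{w, u} V) (b := A) (fixedOut e) := by
  let κ : compDist (fixedIn e) (fixedOut e) ⟶ homDist V A.carrier :=
    compHomMk (fun {b c} _ (y : {f : a ⟶ c // e ≫ f = f}) (v : {f : b ⟶ a // f ≫ e = f}) =>
        v.1 ≫ y.1)
      (fun {b c _ _} _ (y : {f : a ⟶ c // e ≫ f = f}) (v : {f : b ⟶ a // f ≫ e = f}) =>
        show (𝟙 b ≫ v.1) ≫ y.1 = v.1 ≫ y.1 ≫ 𝟙 c by simp)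
      (fun {b b' c c'} f g _ (y : {f : a ⟶ c // e ≫ f = f}) (v : {f : b ⟶ a // f ≫ e = f}) =>
        show (f ≫ v.1) ≫ y.1 ≫ g = f ≫ (v.1 ≫ y.1) ≫ g by simp)
      (fun {b c} _ (y : {f : a ⟶ c // e ≫ f = f}) (v : {f : b ⟶ a // f ≫ e = f}) =>
        hnorm_mul_le v.1 y.1)
  let v : (fixedIn e).El a NCat.star := Subtype.mk e he
  let u : (fixedOut e).El NCat.star a := Subtype.mk e he
  refine isLeftAdjoint_of_element (Ψ := fixedIn e) κ v u
    ((one_le_mul hn hn).trans (le_nrm_pair (fixedOut e) (fixedIn e) v u)) ?_ ?_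
  · rintro b ⟨y, hy⟩
    exact Subtype.ext (show e ≫ e ≫ y = y by rw [hy, hy])
  · rintro b ⟨y, hy⟩
    exact Subtype.ext (show (y ≫ e) ≫ e = y by rw [hy, hy])

/-- A representation of `fixedOut e` splits `e`: the universal element is the retraction, and the
coordinate of `e` is the section. -/
theorem isIdempotentComplete_of_nonempty_representation
    (h : ∀ Φ : NCat.unit.{w, u} V ⟶ A, Bicategory.IsLeftAdjoint Φ →
      Nonempty (Distributor.Representation Φ NCat.star)) :
    IsIdempotentComplete (Underlying V A.carrier) where
  idempotents_split := by
    rintro ⟨a⟩ e' he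
    -- Type ascriptions unfold morphisms of `A_∘` to the subtype of morphisms of norm at least `k`.
    obtain ⟨e, hn⟩ : {f : a ⟶ a // 1 ≤ hnorm V f} := e'
    replace he : e ≫ e = e := congrArg Subtype.val he
    obtain ⟨R⟩ := h (fixedOut e) (isLeftAdjoint_fixedOut e he hn)
    obtain ⟨c, ⟨p, hp⟩, coord, act_coord, coord_act, one_le, nrm_le⟩ := R
    let i : c ⟶ a := coord (b := a) (Subtype.mk e he)
    have hpi : p ≫ i = e := congrArg Subtype.val (act_coord (b := a) (Subtype.mk e he))
    have hip : i ≫ p = 𝟙 c := by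
      have h₁ : coord (b := c) (Subtype.mk p hp) = i ≫ p :=
        (congrArg (coord (b := c)) (Subtype.ext (by
          change p = p ≫ i ≫ p
          rw [reassoc_of% hpi, hp]))).trans (coord_act (i ≫ p))
      have h₂ : coord (b := c) (Subtype.mk p hp) = 𝟙 c :=
        (congrArg (coord (b := c)) (Subtype.ext (by
          change p = p ≫ 𝟙 c
          rw [Category.comp_id]))).trans (coord_act (𝟙 c))
      exact h₁.symm.trans h₂
    exact ⟨⟨c⟩, Subtype.mk i (hn.trans (nrm_le (b := a) (Subtype.mk e he))),
      Subtype.mk p one_le, Subtype.ext hip, Subtype.ext hpi⟩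

end NCat

theorem theorem2 {V : Type w} [CommMonoid V] [CompleteLattice V] [IsQuantale V]
    (A : NCat.{w, u} V) :
    NCat.LawvereComplete A ↔
      IsIdempotentComplete (Underlying V A.carrier) ∧
        ∀ Φ : NCat.unit V ⟶ A, Bicategory.IsLeftAdjoint Φ → NCat.HasPresentableUnit Φ := by
  constructor
  · intro h
    have hr (Φ : NCat.unit.{w, u} V ⟶ A) (hΦ : Bicategory.IsLeftAdjoint Φ) :
        Nonempty (Distributor.Representation Φ NCat.star) :=
      (NCat.representable_iff Φ).1 (h _ Φ hΦ) NCat.star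
    exact ⟨NCat.isIdempotentComplete_of_nonempty_representation hr,
      fun Φ hΦ => NCat.hasPresentableUnit_of_representation (hr Φ hΦ).some⟩
  · rintro ⟨_, h⟩ X Φ hΦ
    refine (NCat.representable_iff Φ).2 fun x => ?_
    obtain ⟨R⟩ := NCat.nonempty_representation_of_hasPresentableUnit
      (h (Distributor.restrict Φ x) (NCat.isLeftAdjoint_restrict hΦ x))
    exact ⟨.ofRestrict R⟩
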